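/- Let $\mathcal G$ be a connected compact metric graph with at least one edge: it has finite sets $V$ of vertices and $E$ of edges, each edge $e$ has a finite length $\ell_e>0$ and is identified with $[0,\ell_e]$, with $0$ corresponding to its initial vertex and $\ell_e$ to its terminal vertex, there are no loops, and no two different edges connect the same pair of vertices. For each $e\in E$ let $1<p_e<\infty$ and let $\gamma_e:\mathbb R\to\mathbb R$ be continuous and increasing (not necessarily strictly), with $\gamma_e(\mathbb R)=\mathbb R$ and $\gamma_e(0)=0$. Let $\mathcal W$ be the set of families $u=([u]_e)_{e\in E}$ with $[u]_e\in W^{1,p_e}(0,\ell_e)$ (continuous representative on $[0,\ell_e]$) such that, at every vertex $w$, the values at $w$ of the $[u]_e$ over all edges $e$ incident to $w$ coincide; the common value is denoted $u(w)$. Then for every $f=([f]_e)_{e\in E}$ with $[f]_e\in L^1(0,\ell_e)$ and every $\omega=(\omega_w)_{w\in V}\in\mathbb R^V$ the problem $$[v]_e-\Delta_{p_e}[u]_e=[f]_e,\quad [v]_e=\gamma_e([u]_e)\ \text{ on } (0,\ell_e)\ (e\in E),\qquad u \text{ continuous},\qquad \partial_\nu^{\overline p}u(w)=\omega_w\ (w\in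 V)$$ has a unique weak solution; that is, there is exactly one $v=([v]_e)_{e\in E}$ with $[v]_e\in L^1(0,\ell_e)$ (up to equality almost everywhere) for which there exists $u\in\mathcal W$ such that $[v]_e=\gamma_e([u]_e)$ a.e. in $(0,\ell_e)$ for all $e\in E$ and $$\sum_{e\in E}\int_0^{\ell_e}[v]_e[\varphi]_e\,dx+\sum_{e\in E}\int_0^{\ell_e}\bigl|[u]_e'\bigr|^{p_e-2}[u]_e'\,[\varphi]_e'\,dx=\sum_{e\in E}\int_0^{\ell_e}[f]_e[\varphi]_e\,dx+\sum_{w\in V}\omega_w\,\varphi(w)\qquad\text{for all }\varphi\in\mathcal W.$$ -/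

import Mathlib

open MeasureTheory Set
open scoped ENNReal

/-- A compact metric graph with vertices `V` and edges `E`: finitely many vertices and edges, and
each edge `e` is identified with the interval `[0, length e]` of finite length, the point `0` being
the vertex `init e` and the point `length e` the vertex `term e`. There are no loops, and no two
different edges connect the same pair of vertices. -/
structure CompactMetricGraph (V E : Type*) [Fintype V] [Fintype E] where
  init : E → V
  term : E → V
  length : E → ℝ
  length_pos : ∀ e, 0 < length e
  no_loops : ∀ e, init e ≠ term e
  no_multiple_edges : ∀ e e', s(init e, term e) = s(init e', term e') → e = e'

namespace CompactMetricGraph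

variable {V E : Type*} [Fintype V] [Fintype E]

/-- The combinatorial graph underlying a metric graph. -/
def toSimpleGraph (G : CompactMetricGraph V E) : SimpleGraph V :=
  SimpleGraph.fromEdgeSet (Set.range fun e => s(G.init e, G.term e))

/-- Any two vertices are joined by a path. -/
def IsConnected (G : CompactMetricGraph V E) : Prop := G.toSimpleGraph.Connected

/-- Lebesgue measure on the open edge `(0, length e)`. -/
noncomputable def edgeMeasure (G : CompactMetricGraph V E) (e : E) : Measure ℝ :=
  volume.restrict (Ioo 0 (G.length e))

/-- The space `L¹(G)`: families of (classes of) integrable functions on the edges. -/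
abbrev L1 (G : CompactMetricGraph V E) : Type _ := ∀ e : E, Lp ℝ 1 (G.edgeMeasure e)

end CompactMetricGraph

/-- `u'` is the weak (distributional) derivative of `u` on the interval `(0, l)`. -/
def IsWeakDerivOn (l : ℝ) (u u' : ℝ → ℝ) : Prop :=
  ∀ φ : ℝ → ℝ, ContDiff ℝ ((⊤ : ℕ∞) : WithTop ℕ∞) φ → HasCompactSupport φ → tsupport φ ⊆ Ioo 0 l →
    ∫ x in Ioo 0 l, u x * deriv φ x = - ∫ x in Ioo 0 l, u' x * φ x

namespace CompactMetricGraph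

variable {V E : Type*} [Fintype V] [Fintype E]

/-- The space of the functions on the metric graph which are `W^{1, p e}` on each edge `e`,
continuous on each closed edge, and continuous at the vertices. An element is given by its
continuous representatives `val e`, its weak derivatives `der e`, and its values `atVertex v` at the
vertices. -/
structure Sobolev (G : CompactMetricGraph V E) (p : E → ℝ) where
  val : E → ℝ → ℝ
  der : E → ℝ → ℝ
  atVertex : V → ℝ
  memLp_val : ∀ e, MemLp (val e) (ENNReal.ofReal (p e)) (G.edgeMeasure e)
  memLp_der : ∀ e, MemLp (der e) (ENNReal.ofReal (p e)) (G.edgeMeasure e)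
  isWeakDerivOn : ∀ e, IsWeakDerivOn (G.length e) (val e) (der e)
  continuousOn_val : ∀ e, ContinuousOn (val e) (Icc 0 (G.length e))
  val_init : ∀ e, val e 0 = atVertex (G.init e)
  val_term : ∀ e, val e (G.length e) = atVertex (G.term e)

/-- `v` is a weak solution of the problem `v - Δ_{p e} u = f` and `v = γ e (u)` on each edge `e`,
with `u` continuous and with flux `ω w` at each vertex `w`. -/
def IsWeakSolution (G : CompactMetricGraph V E) (p : E → ℝ) (γ : E → ℝ → ℝ)
    (f : G.L1) (ω : V → ℝ) (v : G.L1) : Prop :=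
  ∃ u : G.Sobolev p,
    (∀ e, (v e : ℝ → ℝ) =ᵐ[G.edgeMeasure e] fun x => γ e (u.val e x)) ∧
    ∀ φ : G.Sobolev p,
      ∑ e, ∫ x, v e x * φ.val e x ∂(G.edgeMeasure e)
        + ∑ e, ∫ x, |u.der e x| ^ (p e - 2) * u.der e x * φ.der e x ∂(G.edgeMeasure e)
      = ∑ e, ∫ x, f e x * φ.val e x ∂(G.edgeMeasure e) + ∑ w, ω w * φ.atVertex w

end CompactMetricGraph

/-!
The problem is the Euler–Lagrange equation of the energy
`J(u) = ∑ e, ∫ (Γ_e(u) + |u'| ^ p_e / p_e - f u) - ∑ w, ω_w u(w)`, where `Γ_e` is the primitive of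
`γ_e`, on the Sobolev space of the graph, and a solution is found by minimizing `J`.

* A continuous function with weak derivative `u'` satisfies `u x = u 0 + ∫_0^x u'` (du Bois-Reymond,
  `IsWeakDerivOn.eq_add_integral`), so on a connected graph its oscillation is bounded by a multiple
  of `∑ e, ∫ |u'|` (`Sobolev.exists_abs_sub_le`).
* As `γ_e` is onto, `Γ_e` grows faster than any linear function. With the oscillation bound and
  `p_e > 1` this makes `J` coercive (`Sobolev.exists_abs_atVertex_add_le_energy`), although `f` is
  merely integrable and `γ_e` may be constant on intervals.
* No weak compactness is needed. Along a minimizing sequence the midpoint inequality for `J` forces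
  the convexity defects of `∫ |u'| ^ p_e` to zero, and uniform convexity of `|·| ^ p`
  (`exists_abs_sub_rpow_le`) turns this into strong `L^p` convergence of the derivatives
  (`exists_tendsto_of_midpoint_defect`). After passing to a subsequence the vertex values converge
  too, hence so do the functions, uniformly, and the limit is a minimizer
  (`Sobolev.exists_energy_le`).
* `J` is differentiable along lines (`Sobolev.hasDerivAt_energy`), which gives the weak form at the
  minimizer.
* For uniqueness (`IsWeakSolution.unique`), the difference of the two equations is tested with
  `u₁ - u₂`; both `γ_e` and `a ↦ |a| ^ (p - 2) a` are monotone, so every term vanishes.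
-/

/-! ### Convexity of the power function -/

theorem abs_midpoint_rpow_lt {p : ℝ} (hp : 1 < p) {a b : ℝ} (hab : a ≠ b) :
    |(a + b) / 2| ^ p < (|a| ^ p + |b| ^ p) / 2 := by
  by_cases h : |a| = |b|
  · have hb : b = -a := by
      rcases abs_eq_abs.1 h with h | h
      · exact absurd h hab
      · linarith
    have ha : a ≠ 0 := by
      rintro rfl
      simp [hb] at hab
    have : 0 < |a| ^ p := Real.rpow_pos_of_pos (abs_pos.2 ha) p
    rw [← h, hb]
    simp only [add_neg_cancel, zero_div, abs_zero]
    rw [Real.zero_rpow (by linarith)]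
    linarith
  · have h1 := (strictConvexOn_rpow hp).2 (abs_nonneg a) (abs_nonneg b) h
      (show (0 : ℝ) < 1 / 2 by norm_num) (show (0 : ℝ) < 1 / 2 by norm_num) (by norm_num)
    simp only [smul_eq_mul] at h1
    have h2 : |(a + b) / 2| ≤ 1 / 2 * |a| + 1 / 2 * |b| := by
      rw [abs_div, abs_two]
      linarith [abs_add_le a b]
    calc |(a + b) / 2| ^ p ≤ (1 / 2 * |a| + 1 / 2 * |b|) ^ p :=
          Real.rpow_le_rpow (abs_nonneg _) h2 (by linarith)
      _ < _ := h1
      _ = _ := by ring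

theorem abs_midpoint_rpow_le {p : ℝ} (hp : 1 < p) (a b : ℝ) :
    |(a + b) / 2| ^ p ≤ (|a| ^ p + |b| ^ p) / 2 := by
  rcases eq_or_ne a b with rfl | h
  · simp
  · exact (abs_midpoint_rpow_lt hp h).le

/-- A quantitative form of the uniform convexity of `|·| ^ p`: up to an arbitrarily small multiple
of `|a| ^ p + |b| ^ p`, the defect in the midpoint inequality controls `|a - b| ^ p`. By homogeneity
this is a statement about a compact set, on which strict convexity makes the defect positive. -/
theorem exists_abs_sub_rpow_le {p : ℝ} (hp : 1 < p) {ε : ℝ} (hε : 0 < ε) :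
    ∃ C : ℝ, 0 ≤ C ∧ ∀ a b : ℝ, |a - b| ^ p ≤
      ε * (|a| ^ p + |b| ^ p) + C * ((|a| ^ p + |b| ^ p) / 2 - |(a + b) / 2| ^ p) := by
  have hp0 : 0 < p := by linarith
  have hc : ∀ g : ℝ × ℝ → ℝ, Continuous g → Continuous fun z => |g z| ^ p := fun g hg =>
    hg.abs.rpow_const fun _ => Or.inr hp0.le
  have c1 := hc (fun z => z.1) continuous_fst
  have c2 := hc (fun z => z.2) continuous_snd
  have c3 := hc (fun z => z.1 - z.2) (by fun_prop)
  have c4 := hc (fun z => (z.1 + z.2) / 2) (by fun_prop)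
  -- `K` is the part of the unit sphere where the term with `ε` alone does not suffice.
  set K : Set (ℝ × ℝ) := Metric.sphere 0 1 ∩ {z | ε * (|z.1| ^ p + |z.2| ^ p) ≤ |z.1 - z.2| ^ p}
  have hK : IsCompact K := (isCompact_sphere _ _).inter_right
    (isClosed_le (continuous_const.mul (c1.add c2)) c3)
  have hpos : ∀ z ∈ K, 0 < (|z.1| ^ p + |z.2| ^ p) / 2 - |(z.1 + z.2) / 2| ^ p := by
    rintro ⟨a, b⟩ ⟨h1, h2⟩
    refine sub_pos.2 (abs_midpoint_rpow_lt hp ?_)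
    rintro h
    simp only at h
    subst h
    simp only [mem_ofPred_eq, sub_self, abs_zero, Real.zero_rpow hp0.ne'] at h2
    have ha : a ≠ 0 := by
      rintro rfl
      simp at h1
    have : 0 < |a| ^ p := Real.rpow_pos_of_pos (abs_pos.2 ha) p
    nlinarith
  obtain ⟨C, hC⟩ := hK.exists_bound_of_continuousOn
    (f := fun z : ℝ × ℝ => |z.1 - z.2| ^ p / ((|z.1| ^ p + |z.2| ^ p) / 2 - |(z.1 + z.2) / 2| ^ p))
    (c3.continuousOn.div (((c1.add c2).div_const 2).sub c4).continuousOn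
      fun z hz => (hpos z hz).ne')
  have key : ∀ z ∈ Metric.sphere (0 : ℝ × ℝ) 1, |z.1 - z.2| ^ p ≤
      ε * (|z.1| ^ p + |z.2| ^ p)
        + max C 0 * ((|z.1| ^ p + |z.2| ^ p) / 2 - |(z.1 + z.2) / 2| ^ p) := by
    intro z hz
    have h0 := sub_nonneg.2 (abs_midpoint_rpow_le hp z.1 z.2)
    have h1 : 0 ≤ ε * (|z.1| ^ p + |z.2| ^ p) := by positivity
    by_cases h : ε * (|z.1| ^ p + |z.2| ^ p) ≤ |z.1 - z.2| ^ p
    · have h2 := (le_abs_self _).trans (hC z ⟨hz, h⟩)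
      rw [div_le_iff₀ (hpos z ⟨hz, h⟩)] at h2
      have := mul_le_mul_of_nonneg_right (le_max_left C 0) h0
      linarith
    · have := mul_nonneg (le_max_right C 0) h0
      linarith
  refine ⟨max C 0, le_max_right _ _, fun a b => ?_⟩
  by_cases h0 : (a, b) = (0 : ℝ × ℝ)
  · obtain ⟨rfl, rfl⟩ := Prod.mk_eq_zero.1 h0
    simp [Real.zero_rpow hp0.ne']
  -- Both sides are homogeneous of degree `p`, so `(a, b)` may be scaled to norm one.
  set r := ‖((a, b) : ℝ × ℝ)‖ with hr
  have hrpos : 0 < r := norm_pos_iff.2 h0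
  have hk := key (r⁻¹ • (a, b)) (by
    rw [mem_sphere_zero_iff_norm, norm_smul, norm_inv, Real.norm_of_nonneg hrpos.le, ← hr]
    exact inv_mul_cancel₀ hrpos.ne')
  have hs : ∀ x : ℝ, |r⁻¹ * x| ^ p = (r⁻¹) ^ p * |x| ^ p := fun x => by
    rw [abs_mul, abs_of_pos (inv_pos.2 hrpos),
      Real.mul_rpow (inv_pos.2 hrpos).le (abs_nonneg x)]
  simp only [Prod.smul_mk, smul_eq_mul] at hk
  rw [← mul_sub, ← mul_add, mul_div_assoc, hs, hs, hs, hs] at hk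
  have hrp : 0 < (r⁻¹) ^ p := Real.rpow_pos_of_pos (inv_pos.2 hrpos) p
  refine le_of_mul_le_mul_left ?_ hrp
  linarith

/-- Young's inequality with an unspecified constant. -/
theorem exists_mul_le_rpow_add {p : ℝ} (hp : 1 < p) {ε : ℝ} (hε : 0 < ε) {B : ℝ} (hB : 0 ≤ B) :
    ∃ C : ℝ, ∀ t : ℝ, 0 ≤ t → B * t ≤ ε * t ^ p + C := by
  have hp0 : 0 < p - 1 := by linarith
  -- Beyond `t = (B / ε) ^ (p - 1)⁻¹` the power dominates.
  refine ⟨B * (B / ε) ^ (p - 1)⁻¹, fun t ht => ?_⟩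
  have hεt : 0 ≤ ε * t ^ p := by positivity
  rcases le_total t ((B / ε) ^ (p - 1)⁻¹) with h | h
  · linarith [mul_le_mul_of_nonneg_left h hB]
  · have h1 : B / ε ≤ t ^ (p - 1) := by
      have := Real.rpow_le_rpow (by positivity) h hp0.le
      rwa [← Real.rpow_mul (by positivity), inv_mul_cancel₀ hp0.ne', Real.rpow_one] at this
    rw [div_le_iff₀ hε] at h1
    have h2 : t ^ (p - 1) * t = t ^ p := by
      rcases ht.eq_or_lt with rfl | ht
      · rw [Real.zero_rpow (by linarith : p ≠ 0), mul_zero]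
      · rw [← Real.rpow_add_one ht.ne']; ring_nf
    have h3 := mul_le_mul_of_nonneg_right h1 ht
    have h4 : 0 ≤ B * (B / ε) ^ (p - 1)⁻¹ := by positivity
    calc B * t ≤ t ^ (p - 1) * ε * t := h3
      _ = ε * t ^ p := by rw [← h2]; ring
      _ ≤ _ := by linarith

theorem abs_abs_rpow_sub_two_mul {p : ℝ} (hp : 1 < p) (a : ℝ) :
    |(|a| ^ (p - 2) * a)| = |a| ^ (p - 1) := by
  rcases eq_or_ne a 0 with rfl | ha
  · simp [Real.zero_rpow (by linarith : p - 1 ≠ 0)]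
  · rw [abs_mul, abs_of_nonneg (by positivity : 0 ≤ |a| ^ (p - 2)),
      ← Real.rpow_add_one (abs_pos.2 ha).ne']
    ring_nf

theorem abs_rpow_sub_two_mul_mul_self {p : ℝ} (hp : 1 < p) (a : ℝ) :
    |a| ^ (p - 2) * a * a = |a| ^ (p - 1) * |a| := by
  have h : 0 ≤ |a| ^ (p - 2) * a * a := by
    rw [mul_assoc]
    exact mul_nonneg (by positivity) (mul_self_nonneg a)
  rw [← abs_abs_rpow_sub_two_mul hp, ← abs_mul, abs_of_nonneg h]

/-- The `p`-Laplacian flux `a ↦ |a| ^ (p - 2) * a` is monotone. -/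
theorem abs_rpow_sub_two_mul_sub_mul_nonneg {p : ℝ} (hp : 1 < p) (a b : ℝ) :
    0 ≤ (|a| ^ (p - 2) * a - |b| ^ (p - 2) * b) * (a - b) := by
  have h1 : |a| ^ (p - 2) * a * b ≤ |a| ^ (p - 1) * |b| := by
    rw [← abs_abs_rpow_sub_two_mul hp, ← abs_mul]; exact le_abs_self _
  have h2 : |b| ^ (p - 2) * b * a ≤ |b| ^ (p - 1) * |a| := by
    rw [← abs_abs_rpow_sub_two_mul hp, ← abs_mul]; exact le_abs_self _
  have h3 := abs_rpow_sub_two_mul_mul_self hp a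
  have h4 := abs_rpow_sub_two_mul_mul_self hp b
  have h5 : 0 ≤ (|a| ^ (p - 1) - |b| ^ (p - 1)) * (|a| - |b|) := by
    rcases le_total |a| |b| with h | h
    · exact mul_nonneg_of_nonpos_of_nonpos (sub_nonpos.2
        (Real.rpow_le_rpow (abs_nonneg _) h (by linarith))) (sub_nonpos.2 h)
    · exact mul_nonneg (sub_nonneg.2
        (Real.rpow_le_rpow (abs_nonneg _) h (by linarith))) (sub_nonneg.2 h)
  nlinarith

theorem abs_rpow_sub_two_mul_mul_abs_le {p : ℝ} (hp : 1 < p) {a b c : ℝ} (ha : |a| ≤ c)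
    (hb : |b| ≤ c) : |(|a| ^ (p - 2) * a * b)| ≤ |c| ^ p := by
  have hc : 0 ≤ c := (abs_nonneg a).trans ha
  rw [abs_mul, abs_abs_rpow_sub_two_mul hp, abs_of_nonneg hc]
  calc |a| ^ (p - 1) * |b| ≤ c ^ (p - 1) * c := by gcongr
    _ = c ^ p := by
      rcases hc.eq_or_lt with rfl | hc
      · rw [Real.zero_rpow (by linarith : p ≠ 0), mul_zero]
      · rw [← Real.rpow_add_one hc.ne']; ring_nf

/-! ### Primitives of monotone functions -/

/-- The primitive of `γ` that vanishes at `0`. -/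
noncomputable def primitive (γ : ℝ → ℝ) (r : ℝ) : ℝ := ∫ s in (0 : ℝ)..r, γ s

section primitive

variable {γ : ℝ → ℝ}

theorem hasDerivAt_primitive (hc : Continuous γ) (r : ℝ) : HasDerivAt (primitive γ) (γ r) r :=
  intervalIntegral.integral_hasDerivAt_right (hc.intervalIntegrable _ _)
    hc.stronglyMeasurable.stronglyMeasurableAtFilter hc.continuousAt

theorem continuous_primitive (hc : Continuous γ) : Continuous (primitive γ) :=
  continuous_iff_continuousAt.2 fun r => (hasDerivAt_primitive hc r).continuousAt

/-- The primitive of a monotone function is convex: it lies above its tangents. -/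
theorem primitive_add_mul_sub_le (hc : Continuous γ) (hm : Monotone γ) (s r : ℝ) :
    primitive γ s + γ s * (r - s) ≤ primitive γ r := by
  have h : primitive γ r - primitive γ s = ∫ t in s..r, γ t :=
    intervalIntegral.integral_interval_sub_left (hc.intervalIntegrable _ _)
      (hc.intervalIntegrable _ _)
  have h2 : ∫ _ in s..r, γ s = γ s * (r - s) := by simp [mul_comm]
  rcases le_total s r with hsr | hsr
  · have := intervalIntegral.integral_mono_on (μ := volume) hsr intervalIntegrable_const
      (hc.intervalIntegrable s r)
      (f := fun _ => γ s) fun x hx => hm hx.1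
    linarith
  · have := intervalIntegral.integral_mono_on (μ := volume) hsr (hc.intervalIntegrable r s)
      intervalIntegrable_const
      (g := fun _ => γ s) fun x hx => hm hx.2
    rw [intervalIntegral.integral_symm, intervalIntegral.integral_symm s r] at this
    linarith

theorem primitive_nonneg (hc : Continuous γ) (hm : Monotone γ) (h0 : γ 0 = 0) (r : ℝ) :
    0 ≤ primitive γ r := by
  have := primitive_add_mul_sub_le hc hm 0 r
  simpa [h0, primitive] using this

theorem primitive_midpoint_le (hc : Continuous γ) (hm : Monotone γ) (a b : ℝ) :
    primitive γ ((a + b) / 2) ≤ (primitive γ a + primitive γ b) / 2 := by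
  have h1 := primitive_add_mul_sub_le hc hm ((a + b) / 2) a
  have h2 := primitive_add_mul_sub_le hc hm ((a + b) / 2) b
  linarith

/-- The primitive of a surjective monotone function grows faster than any linear function: it lies
above its tangents of slopes `K` and `-K`. -/
theorem exists_mul_abs_sub_le_primitive (hc : Continuous γ) (hm : Monotone γ)
    (hs : Function.Surjective γ) (K : ℝ) : ∃ C : ℝ, ∀ r, K * |r| - C ≤ primitive γ r := by
  obtain ⟨s, hs1⟩ := hs K
  obtain ⟨t, ht⟩ := hs (-K)
  refine ⟨max (K * s - primitive γ s) (-K * t - primitive γ t), fun r => ?_⟩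
  have h1 := primitive_add_mul_sub_le hc hm s r
  have h2 := primitive_add_mul_sub_le hc hm t r
  rw [hs1] at h1
  rw [ht] at h2
  have h3 := le_max_left (K * s - primitive γ s) (-K * t - primitive γ t)
  have h4 := le_max_right (K * s - primitive γ s) (-K * t - primitive γ t)
  rcases abs_cases r with ⟨h, _⟩ | ⟨h, _⟩ <;> rw [h] <;> linarith

end primitive

/-! ### Weak derivatives on an interval -/

/-- A function that is smooth with compact support in `(0, l)` and has integral zero is the
derivative of such a function. -/
theorem exists_deriv_eq_of_integral_eq_zero {l : ℝ} {ψ : ℝ → ℝ}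
    (hψ : ContDiff ℝ ((⊤ : ℕ∞) : WithTop ℕ∞) ψ) (hcs : HasCompactSupport ψ)
    (hsupp : tsupport ψ ⊆ Ioo 0 l) (h0 : ∫ x, ψ x = 0) :
    ∃ φ : ℝ → ℝ, ContDiff ℝ ((⊤ : ℕ∞) : WithTop ℕ∞) φ ∧ HasCompactSupport φ ∧
      tsupport φ ⊆ Ioo 0 l ∧ deriv φ = ψ := by
  rcases (tsupport ψ).eq_empty_or_nonempty with he | hne
  · have : ψ = 0 := tsupport_eq_empty_iff.1 he
    exact ⟨0, contDiff_const, HasCompactSupport.zero, by simp, by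
      rw [this]; ext x; simp⟩
  have hcomp : IsCompact (tsupport ψ) := hcs
  obtain ⟨a, ha, hamin⟩ := hcomp.exists_isLeast hne
  obtain ⟨b, hb, hbmax⟩ := hcomp.exists_isGreatest hne
  have hzero : ∀ x, x ∉ Icc a b → ψ x = 0 := fun x hx => by
    by_contra h
    exact hx ⟨hamin (subset_tsupport _ h), hbmax (subset_tsupport _ h)⟩
  have hd : ∀ x, HasDerivAt (fun y => ∫ t in a..y, ψ t) (ψ x) x := fun x =>
    intervalIntegral.integral_hasDerivAt_right (hψ.continuous.intervalIntegrable _ _)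
      hψ.continuous.stronglyMeasurable.stronglyMeasurableAtFilter hψ.continuous.continuousAt
  have hder : deriv (fun y => ∫ t in a..y, ψ t) = ψ := funext fun x => (hd x).deriv
  have hout : ∀ x, x ∉ Icc a b → ∫ t in a..x, ψ t = 0 := by
    intro x hx
    rcases lt_or_ge x a with hxa | hxa
    · rw [intervalIntegral.integral_symm, intervalIntegral.integral_of_le hxa.le,
        integral_Ioc_eq_integral_Ioo, setIntegral_eq_zero_of_forall_eq_zero, neg_zero]
      exact fun t ht => hzero t fun h => not_lt.2 h.1 ht.2
    · have hbx : b < x := not_le.1 fun h => hx ⟨hxa, h⟩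
      rw [intervalIntegral.integral_of_le hxa, ← h0, ← integral_Icc_eq_integral_Ioc]
      refine setIntegral_eq_integral_of_forall_compl_eq_zero fun t ht => hzero t fun h => ?_
      exact ht ⟨h.1, h.2.trans hbx.le⟩
  have hsub : tsupport (fun y => ∫ t in a..y, ψ t) ⊆ Icc a b :=
    closure_minimal (fun x hx => by
      by_contra h
      exact hx (hout x h)) isClosed_Icc
  refine ⟨_, ?_, HasCompactSupport.of_support_subset_isCompact isCompact_Icc
    (subset_closure.trans hsub), hsub.trans fun x hx => ⟨?_, ?_⟩, hder⟩
  · exact contDiff_infty_iff_deriv.2 ⟨fun x => (hd x).differentiableAt, by rw [hder]; exact hψ⟩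
  · exact (hsupp ha).1.trans_le hx.1
  · exact hx.2.trans_lt (hsupp hb).2

/-- The du Bois-Reymond lemma: a continuous function on `[0, l]` whose weak derivative vanishes is
constant. -/
theorem IsWeakDerivOn.eq_of_zero {l : ℝ} (hl : 0 < l) {h : ℝ → ℝ}
    (hw : IsWeakDerivOn l h 0) (hc : ContinuousOn h (Icc 0 l)) :
    ∀ x ∈ Icc 0 l, h x = h 0 := by
  have hmul : ∀ ψ : ℝ → ℝ, Continuous ψ → IntegrableOn (fun x => h x * ψ x) (Ioo 0 l) :=
    fun ψ hψ => ((hc.mul hψ.continuousOn).integrableOn_Icc).mono_set Ioo_subset_Icc_self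
  have hset : ∀ ψ : ℝ → ℝ, tsupport ψ ⊆ Ioo 0 l → ∀ g : ℝ → ℝ,
      ∫ x in Ioo 0 l, g x * ψ x = ∫ x, g x * ψ x := fun ψ hψ g =>
    setIntegral_eq_integral_of_forall_compl_eq_zero fun x hx => by
      rw [image_eq_zero_of_notMem_tsupport fun h' => hx (hψ h'), mul_zero]
  -- A bump function of integral one inside `(0, l)`.
  let B : ContDiffBump (l / 2) := ⟨l / 8, l / 4, by linarith, by linarith⟩
  set η : ℝ → ℝ := B.normed volume with hη
  have hη1 : ContDiff ℝ ((⊤ : ℕ∞) : WithTop ℕ∞) η := B.contDiff_normed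
  have hη2 : HasCompactSupport η := B.hasCompactSupport_normed
  have hη3 : tsupport η ⊆ Ioo 0 l := by
    rw [hη, B.tsupport_normed_eq, Real.closedBall_eq_Icc]
    intro x hx
    have h1 : l / 2 - l / 4 ≤ x := hx.1
    have h2 : x ≤ l / 2 + l / 4 := hx.2
    exact ⟨by linarith, by linarith⟩
  have hη4 : ∫ x, η x = 1 := B.integral_normed
  set c := ∫ x in Ioo 0 l, h x * η x with hcdef
  have hae : ∀ᵐ x, x ∈ Ioo 0 l → h x - c = 0 := by
    refine IsOpen.ae_eq_zero_of_integral_contDiff_smul_eq_zero isOpen_Ioo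
      (((hc.sub continuousOn_const).integrableOn_Icc.mono_set
        Ioo_subset_Icc_self).locallyIntegrableOn) fun ψ hψ hψc hψs => ?_
    set s := ∫ x, ψ x with hs
    have hts : tsupport (fun x => ψ x - s * η x) ⊆ Ioo 0 l :=
      (tsupport_sub (f := ψ) (g := fun x => s * η x)).trans
        (union_subset hψs ((tsupport_mul_subset_right (f := fun _ => s)).trans hη3))
    have hcs : HasCompactSupport (fun x => ψ x - s * η x) := hψc.sub hη2.mul_left
    -- Subtracting a multiple of the bump makes the integral zero, so the result is a derivative.
    obtain ⟨φ, hφ1, hφ2, hφ3, hφ4⟩ := exists_deriv_eq_of_integral_eq_zero (l := l)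
      (ψ := fun x => ψ x - s * η x) (hψ.sub (contDiff_const.mul hη1)) hcs hts (by
        rw [integral_sub (hψ.continuous.integrable_of_hasCompactSupport hψc)
          ((hη1.continuous.integrable_of_hasCompactSupport hη2).const_mul s),
          integral_const_mul, hη4, ← hs]
        ring)
    have hk := hw φ hφ1 hφ2 hφ3
    simp only [hφ4, Pi.zero_apply, zero_mul, integral_zero, neg_zero] at hk
    have e1 : ∫ x in Ioo 0 l, h x * (ψ x - s * η x)
        = ∫ x in Ioo 0 l, h x * ψ x - s * (h x * η x) := by congr 1; ext x; ring
    rw [e1, integral_sub (hmul ψ hψ.continuous) ((hmul η hη1.continuous).const_mul s),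
      integral_const_mul, ← hcdef] at hk
    have e2 : ∫ x, ψ x • (h x - c) = ∫ x in Ioo 0 l, h x * ψ x - c * ψ x := by
      rw [← setIntegral_eq_integral_of_forall_compl_eq_zero (s := Ioo 0 l)]
      · congr 1; ext x; simp only [smul_eq_mul]; ring
      · intro x hx
        rw [image_eq_zero_of_notMem_tsupport fun h' => hx (hψs h'), zero_smul]
    rw [e2, integral_sub (hmul ψ hψ.continuous)
      ((hψ.continuous.integrable_of_hasCompactSupport hψc).integrableOn.const_mul c),
      hset ψ hψs (fun _ => c), integral_const_mul, ← hs]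
    linarith
  have heq : EqOn h (fun _ => c) (Ioo 0 l) := by
    refine Measure.eqOn_open_of_ae_eq (μ := volume) ?_ isOpen_Ioo
      (hc.mono Ioo_subset_Icc_self) continuousOn_const
    refine (ae_restrict_iff' measurableSet_Ioo).2 (hae.mono fun x hx hx' => ?_)
    have := hx hx'
    linarith
  have heq2 : EqOn h (fun _ => c) (Icc 0 l) :=
    heq.of_subset_closure hc continuousOn_const Ioo_subset_Icc_self
      (by rw [closure_Ioo hl.ne])
  intro x hx
  rw [heq2 hx, heq2 (left_mem_Icc.2 hl.le)]

/-- An indefinite integral of an integrable function has that function as its weak derivative. -/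
theorem isWeakDerivOn_const_add_integral {l : ℝ} (hl : 0 < l) {g : ℝ → ℝ}
    (hg : IntegrableOn g (Ioo 0 l)) (c : ℝ) :
    IsWeakDerivOn l (fun x => c + ∫ t in (0 : ℝ)..x, g t) g := by
  intro φ hφ hφc hφs
  have hgi : IntervalIntegrable g volume 0 l :=
    (intervalIntegrable_iff_integrableOn_Ioo_of_le hl.le).2 hg
  have hac : AbsolutelyContinuousOnInterval (fun x => c + ∫ t in (0 : ℝ)..x, g t) 0 l :=
    (contDiffOn_const (c := c)).absolutelyContinuousOnInterval.add
      (hgi.absolutelyContinuousOnInterval_intervalIntegral (c := 0) (by simp))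
  have hφac : AbsolutelyContinuousOnInterval φ 0 l :=
    (hφ.of_le (by simp)).contDiffOn.absolutelyContinuousOnInterval
  have h := AbsolutelyContinuousOnInterval.integral_mul_deriv_eq_deriv_mul hac hφac
  have h0 : φ 0 = 0 := image_eq_zero_of_notMem_tsupport fun h' => lt_irrefl _ (hφs h').1
  have hl0 : φ l = 0 := image_eq_zero_of_notMem_tsupport fun h' => lt_irrefl _ (hφs h').2
  simp only [h0, hl0, mul_zero, sub_zero, zero_sub] at h
  rw [intervalIntegral.integral_of_le hl.le, intervalIntegral.integral_of_le hl.le,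
    integral_Ioc_eq_integral_Ioo, integral_Ioc_eq_integral_Ioo] at h
  rw [h, neg_inj]
  refine setIntegral_congr_ae measurableSet_Ioo ?_
  filter_upwards [hgi.ae_hasDerivAt_integral] with x hx hx'
  rw [((hx (by rw [uIcc_of_le hl.le]; exact Ioo_subset_Icc_self hx') 0
    (by simp)).const_add c).deriv]

/-- The fundamental theorem of calculus for weakly differentiable functions. -/
theorem IsWeakDerivOn.eq_add_integral {l : ℝ} (hl : 0 < l) {u g : ℝ → ℝ}
    (hw : IsWeakDerivOn l u g) (hc : ContinuousOn u (Icc 0 l)) (hg : IntegrableOn g (Ioo 0 l)) :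
    ∀ x ∈ Icc 0 l, u x = u 0 + ∫ t in (0 : ℝ)..x, g t := by
  have hgi : IntegrableOn g (Icc 0 l) := by rwa [integrableOn_Icc_iff_integrableOn_Ioo]
  have hcg : ContinuousOn (fun x => ∫ t in (0 : ℝ)..x, g t) (Icc 0 l) := by
    have := intervalIntegral.continuousOn_primitive_interval (μ := volume) (f := g) (a := 0) (b := l)
    rw [uIcc_of_le hl.le] at this
    exact this hgi
  have h := IsWeakDerivOn.eq_of_zero hl (h := fun x => u x - ∫ t in (0 : ℝ)..x, g t) (by
    intro φ hφ hφc hφs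
    have h1 := hw φ hφ hφc hφs
    have h2 := isWeakDerivOn_const_add_integral hl hg 0 φ hφ hφc hφs
    have hd := (hφ.continuous_deriv (by simp)).continuousOn (s := Icc 0 l)
    have e := integral_sub (μ := volume.restrict (Ioo 0 l))
      ((hc.mul hd).integrableOn_Icc.mono_set Ioo_subset_Icc_self)
      ((hcg.mul hd).integrableOn_Icc.mono_set Ioo_subset_Icc_self)
    simp only [Pi.mul_apply] at e
    simp only [zero_add] at h2
    simp only [sub_mul]
    rw [e, h1, h2]
    simp) (hc.sub hcg)
  intro x hx
  have := h x hx
  simp only [intervalIntegral.integral_same, sub_zero] at this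
  linarith

theorem IsWeakDerivOn.abs_sub_le {l : ℝ} (hl : 0 < l) {u g : ℝ → ℝ}
    (hw : IsWeakDerivOn l u g) (hc : ContinuousOn u (Icc 0 l)) (hg : IntegrableOn g (Ioo 0 l))
    {x : ℝ} (hx : x ∈ Icc 0 l) : |u x - u 0| ≤ ∫ t in Ioo 0 l, |g t| := by
  rw [hw.eq_add_integral hl hc hg x hx, add_sub_cancel_left,
    intervalIntegral.integral_of_le hx.1, integral_Ioc_eq_integral_Ioo]
  calc |∫ t in Ioo 0 x, g t| ≤ ∫ t in Ioo 0 x, |g t| := abs_integral_le_integral_abs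
    _ ≤ _ := setIntegral_mono_set hg.abs (ae_of_all _ fun t => abs_nonneg _)
      (Ioo_subset_Ioo_right hx.2).eventuallyLE

namespace CompactMetricGraph

/-! ### Functions on the metric graph -/

section

variable {V E : Type*} [Fintype V] [Fintype E] (G : CompactMetricGraph V E)

instance (e : E) : IsFiniteMeasure (G.edgeMeasure e) := by
  unfold edgeMeasure
  infer_instance

theorem ae_mem_Icc (e : E) : ∀ᵐ x ∂(G.edgeMeasure e), x ∈ Icc 0 (G.length e) :=
  (ae_restrict_mem measurableSet_Ioo).mono fun _ hx => Ioo_subset_Icc_self hx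

theorem edgeMeasure_real_univ (e : E) : (G.edgeMeasure e).real univ = G.length e := by
  simp [edgeMeasure, Measure.real, (G.length_pos e).le]

theorem aestronglyMeasurable_of_continuousOn (e : E) {g : ℝ → ℝ}
    (hg : ContinuousOn g (Icc 0 (G.length e))) : AEStronglyMeasurable g (G.edgeMeasure e) :=
  (hg.mono Ioo_subset_Icc_self).aestronglyMeasurable measurableSet_Ioo

theorem integrable_of_continuousOn (e : E) {g : ℝ → ℝ} (hg : ContinuousOn g (Icc 0 (G.length e))) :
    Integrable g (G.edgeMeasure e) :=
  hg.integrableOn_Icc.mono_set Ioo_subset_Icc_self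

theorem integrable_mul_of_continuousOn (e : E) {f g : ℝ → ℝ} (hf : Integrable f (G.edgeMeasure e))
    (hg : ContinuousOn g (Icc 0 (G.length e))) :
    Integrable (fun x => f x * g x) (G.edgeMeasure e) := by
  obtain ⟨C, hC⟩ := isCompact_Icc.exists_bound_of_continuousOn hg
  exact hf.mul_bdd (c := C) (G.aestronglyMeasurable_of_continuousOn e hg)
    ((G.ae_mem_Icc e).mono fun x hx => hC x hx)

end

namespace Sobolev

variable {V E : Type*} [Fintype V] [Fintype E] {G : CompactMetricGraph V E} {p : E → ℝ}

/-- The linear combination `a • u + b • w`. The bound `1 < p e` makes the weak derivatives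
integrable, so that the integrals in the definition of a weak derivative are additive. -/
def lin (a : ℝ) (u : G.Sobolev p) (b : ℝ) (w : G.Sobolev p) (hp : ∀ e, 1 < p e) : G.Sobolev p where
  val e x := a * u.val e x + b * w.val e x
  der e x := a * u.der e x + b * w.der e x
  atVertex v := a * u.atVertex v + b * w.atVertex v
  memLp_val e := ((u.memLp_val e).const_mul a).add ((w.memLp_val e).const_mul b)
  memLp_der e := ((u.memLp_der e).const_mul a).add ((w.memLp_der e).const_mul b)
  isWeakDerivOn e φ hφ hφc hφs := by
    have h1 := u.isWeakDerivOn e φ hφ hφc hφs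
    have h2 := w.isWeakDerivOn e φ hφ hφc hφs
    have hp1 : (1 : ℝ≥0∞) ≤ ENNReal.ofReal (p e) := ENNReal.one_le_ofReal.2 (hp e).le
    have hd := (hφ.continuous_deriv (by simp)).continuousOn (s := Icc 0 (G.length e))
    have i1 := (G.integrable_of_continuousOn e ((u.continuousOn_val e).mul hd)).const_mul a
    have i2 := (G.integrable_of_continuousOn e ((w.continuousOn_val e).mul hd)).const_mul b
    have i3 := (G.integrable_mul_of_continuousOn e ((u.memLp_der e).integrable hp1)
      hφ.continuous.continuousOn).const_mul a
    have i4 := (G.integrable_mul_of_continuousOn e ((w.memLp_der e).integrable hp1)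
      hφ.continuous.continuousOn).const_mul b
    have e1 := integral_add i1 i2
    have e2 := integral_add i3 i4
    simp only [integral_const_mul] at e1 e2
    simp only [edgeMeasure, Pi.mul_apply] at e1 e2
    simp only [add_mul, mul_assoc]
    rw [e1, e2, h1, h2]
    ring
  continuousOn_val e := (continuousOn_const.mul (u.continuousOn_val e)).add
    (continuousOn_const.mul (w.continuousOn_val e))
  val_init e := by rw [u.val_init, w.val_init]
  val_term e := by rw [u.val_term, w.val_term]

theorem integrable_der (u : G.Sobolev p) (hp : ∀ e, 1 < p e) (e : E) :
    Integrable (u.der e) (G.edgeMeasure e) :=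
  (u.memLp_der e).integrable (ENNReal.one_le_ofReal.2 (hp e).le)

theorem integrable_abs_der_rpow (u : G.Sobolev p) (hp : ∀ e, 1 < p e) (e : E) :
    Integrable (fun x => |u.der e x| ^ p e) (G.edgeMeasure e) := by
  have := (u.memLp_der e).integrable_norm_rpow'
  rwa [ENNReal.toReal_ofReal (by linarith [hp e])] at this

/-- The flux `|u'| ^ (p - 2) * u'` can be integrated against any `L^p` derivative. -/
theorem integrable_flux_mul (u φ : G.Sobolev p) (hp : ∀ e, 1 < p e) (e : E) :
    Integrable (fun x => |u.der e x| ^ (p e - 2) * u.der e x * φ.der e x) (G.edgeMeasure e) := by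
  have h : MemLp (fun x => |u.der e x| + |φ.der e x|) (ENNReal.ofReal (p e)) (G.edgeMeasure e) :=
    (u.memLp_der e).norm.add (φ.memLp_der e).norm
  have h1 := h.integrable_norm_rpow'
  rw [ENNReal.toReal_ofReal (by linarith [hp e])] at h1
  refine h1.mono' ?_ (ae_of_all _ fun x => ?_)
  · have hu := (u.memLp_der e).aestronglyMeasurable.aemeasurable
    have hφ := (φ.memLp_der e).aestronglyMeasurable.aemeasurable
    have hu' : AEMeasurable (fun x => |u.der e x|) (G.edgeMeasure e) := hu.abs
    exact (((hu'.pow_const _).mul hu).mul hφ).aestronglyMeasurable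
  · exact abs_rpow_sub_two_mul_mul_abs_le (hp e) (le_add_of_nonneg_right (abs_nonneg _))
      (le_add_of_nonneg_left (abs_nonneg _))

/-- The total variation of a Sobolev function on the graph, `∑ e, ∫ |u'|`. -/
noncomputable def variation (u : G.Sobolev p) : ℝ := ∑ e, ∫ x, |u.der e x| ∂(G.edgeMeasure e)

theorem integral_abs_der_le_variation (u : G.Sobolev p) (e : E) :
    ∫ x, |u.der e x| ∂(G.edgeMeasure e) ≤ u.variation :=
  Finset.single_le_sum (f := fun e => ∫ x, |u.der e x| ∂(G.edgeMeasure e))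
    (fun _ _ => integral_nonneg fun _ => abs_nonneg _) (Finset.mem_univ e)

theorem variation_nonneg (u : G.Sobolev p) : 0 ≤ u.variation :=
  Finset.sum_nonneg fun _ _ => integral_nonneg fun _ => abs_nonneg _

theorem abs_val_sub_atVertex_init_le (u : G.Sobolev p) (hp : ∀ e, 1 < p e) (e : E) {x : ℝ}
    (hx : x ∈ Icc 0 (G.length e)) : |u.val e x - u.atVertex (G.init e)| ≤ u.variation := by
  rw [← u.val_init]
  exact (IsWeakDerivOn.abs_sub_le (G.length_pos e) (u.isWeakDerivOn e) (u.continuousOn_val e)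
    (u.integrable_der hp e) hx).trans (u.integral_abs_der_le_variation e)

theorem abs_atVertex_sub_le_of_walk (u : G.Sobolev p) (hp : ∀ e, 1 < p e) {v w : V}
    (q : G.toSimpleGraph.Walk v w) :
    |u.atVertex v - u.atVertex w| ≤ q.length * u.variation := by
  induction q with
  | nil => simp
  | @cons a b c h q ih =>
    have hab : |u.atVertex a - u.atVertex b| ≤ u.variation := by
      obtain ⟨⟨e, he⟩, -⟩ := (SimpleGraph.fromEdgeSet_adj _).1 h
      have h1 := u.abs_val_sub_atVertex_init_le hp e (right_mem_Icc.2 (G.length_pos e).le)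
      rw [u.val_term] at h1
      rcases Sym2.eq_iff.1 he with ⟨rfl, rfl⟩ | ⟨rfl, rfl⟩
      · rwa [abs_sub_comm]
      · exact h1
    have := abs_sub_le (u.atVertex a) (u.atVertex b) (u.atVertex c)
    rw [SimpleGraph.Walk.length_cons]
    push_cast
    linarith

/-- On a connected graph, the oscillation of a Sobolev function is controlled by its variation. -/
theorem exists_abs_sub_le (hG : G.IsConnected) (hp : ∀ e, 1 < p e) (w₀ : V) :
    ∃ C : ℝ, 0 ≤ C ∧ ∀ u : G.Sobolev p,
      (∀ w, |u.atVertex w - u.atVertex w₀| ≤ C * u.variation) ∧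
      ∀ e, ∀ x ∈ Icc 0 (G.length e), |u.val e x - u.atVertex w₀| ≤ C * u.variation := by
  have h : ∀ w, ∃ n : ℕ, ∀ u : G.Sobolev p,
      |u.atVertex w - u.atVertex w₀| ≤ n * u.variation := fun w =>
    let ⟨q⟩ := hG.preconnected w w₀
    ⟨q.length, fun u => u.abs_atVertex_sub_le_of_walk hp q⟩
  choose d hd using h
  have hle : ∀ w, (d w : ℝ) ≤ ∑ w, (d w : ℝ) := fun w =>
    Finset.single_le_sum (f := fun w => (d w : ℝ)) (fun _ _ => Nat.cast_nonneg _)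
      (Finset.mem_univ w)
  refine ⟨∑ w, (d w : ℝ) + 1, by positivity, fun u => ?_⟩
  have hv : ∀ w, |u.atVertex w - u.atVertex w₀| ≤ (∑ w, (d w : ℝ)) * u.variation := fun w =>
    (hd w u).trans (mul_le_mul_of_nonneg_right (hle w) u.variation_nonneg)
  refine ⟨fun w => ?_, fun e x hx => ?_⟩
  · linarith [hv w, u.variation_nonneg]
  · have h1 := u.abs_val_sub_atVertex_init_le hp e hx
    have h2 := hv (G.init e)
    have h3 := abs_sub_le (u.val e x) (u.atVertex (G.init e)) (u.atVertex w₀)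
    linarith

end Sobolev

end CompactMetricGraph

/-! ### Strong convergence from small convexity defects -/

theorem norm_toLp_rpow {α : Type*} [MeasurableSpace α] {μ : Measure α} {p : ℝ} (hp : 0 < p)
    {f : α → ℝ} (hf : MemLp f (ENNReal.ofReal p) μ) :
    ‖hf.toLp f‖ ^ p = ∫ x, |f x| ^ p ∂μ := by
  have h0 : 0 ≤ ∫ x, |f x| ^ p ∂μ := integral_nonneg fun x => by positivity
  rw [Lp.norm_toLp, hf.eLpNorm_eq_integral_rpow_norm (by simpa using hp) ENNReal.ofReal_ne_top,
    ENNReal.toReal_ofReal hp.le]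
  simp only [Real.norm_eq_abs]
  rw [ENNReal.toReal_ofReal (by positivity), ← Real.rpow_mul h0, inv_mul_cancel₀ hp.ne',
    Real.rpow_one]

/-- A bounded sequence in `L^p`, `1 < p`, along which the defect in the midpoint inequality for
`∫ |·| ^ p` tends to zero converges strongly: by uniform convexity it is a Cauchy sequence. -/
theorem exists_tendsto_of_midpoint_defect {α : Type*} [MeasurableSpace α] {μ : Measure α}
    [IsFiniteMeasure μ] {p : ℝ} (hp : 1 < p) {f : ℕ → α → ℝ}
    (hf : ∀ n, MemLp (f n) (ENNReal.ofReal p) μ) {R : ℝ} (hR : ∀ n, ∫ x, |f n x| ^ p ∂μ ≤ R)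
    {δ : ℕ → ℝ} (hδ : Filter.Tendsto δ Filter.atTop (nhds 0))
    (hdef : ∀ n m, ∫ x, ((|f n x| ^ p + |f m x| ^ p) / 2 - |(f n x + f m x) / 2| ^ p) ∂μ
      ≤ δ n + δ m) :
    ∃ g : α → ℝ, MemLp g (ENNReal.ofReal p) μ ∧
      Filter.Tendsto (fun n => ∫ x, |f n x - g x| ∂μ) Filter.atTop (nhds 0) ∧
      Filter.Tendsto (fun n => ∫ x, |f n x| ^ p ∂μ) Filter.atTop
        (nhds (∫ x, |g x| ^ p ∂μ)) := by
  have hp0 : 0 < p := by linarith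
  have hp1 : (1 : ℝ≥0∞) ≤ ENNReal.ofReal p := ENNReal.one_le_ofReal.2 hp.le
  have : Fact ((1 : ℝ≥0∞) ≤ ENNReal.ofReal p) := ⟨hp1⟩
  have hint : ∀ h : α → ℝ, MemLp h (ENNReal.ofReal p) μ → Integrable (fun x => |h x| ^ p) μ := by
    intro h hh
    have := hh.integrable_norm_rpow'
    rwa [ENNReal.toReal_ofReal hp0.le] at this
  have hmid : ∀ n m, MemLp (fun x => (f n x + f m x) / 2) (ENNReal.ofReal p) μ := fun n m => by
    simpa only [div_eq_inv_mul, Pi.add_apply] using ((hf n).add (hf m)).const_mul (2⁻¹ : ℝ)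
  have hR0 : 0 ≤ R := (integral_nonneg fun x => by positivity).trans (hR 0)
  have hcau : CauchySeq fun n => (hf n).toLp (f n) := by
    refine Metric.cauchySeq_iff.2 fun ε hε => ?_
    have hεp : 0 < ε ^ p := by positivity
    obtain ⟨C, hC0, hC⟩ := exists_abs_sub_rpow_le hp (ε := ε ^ p / (4 * (R + 1))) (by positivity)
    have hCδ : Filter.Tendsto (fun n => C * δ n) Filter.atTop (nhds 0) := by
      simpa using hδ.const_mul C
    obtain ⟨N, hN⟩ := Filter.eventually_atTop.1
      (hCδ.eventually (gt_mem_nhds (show (0 : ℝ) < ε ^ p / 4 by positivity)))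
    refine ⟨N, fun n hn m hm => ?_⟩
    rw [dist_eq_norm, ← MemLp.toLp_sub]
    rw [← Real.rpow_lt_rpow_iff (norm_nonneg _) hε.le hp0, norm_toLp_rpow hp0]
    have i1 := ((hint _ (hf n)).add (hint _ (hf m))).const_mul (ε ^ p / (4 * (R + 1)))
    have i2 := ((((hint _ (hf n)).add (hint _ (hf m))).div_const 2).sub
      (hint _ (hmid n m))).const_mul C
    have h1 := integral_mono (hint _ ((hf n).sub (hf m))) (i1.add i2) fun x => hC (f n x) (f m x)
    have h2 := integral_add i1 i2
    have h3 := integral_add (hint _ (hf n)) (hint _ (hf m))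
    simp only [integral_const_mul, Pi.add_apply, Pi.sub_apply] at h1 h2 h3
    rw [h2, h3] at h1
    have h4 : ε ^ p / (4 * (R + 1)) * (∫ x, |f n x| ^ p ∂μ + ∫ x, |f m x| ^ p ∂μ)
        ≤ ε ^ p / 2 := by
      calc _ ≤ ε ^ p / (4 * (R + 1)) * (2 * (R + 1)) := by
            gcongr
            linarith [hR n, hR m]
        _ = ε ^ p / 2 := by field_simp; norm_num
    have h5 := mul_le_mul_of_nonneg_left (hdef n m) hC0
    have h6 := hN n hn
    have h7 := hN m hm
    simp only [Pi.sub_apply]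
    linarith
  obtain ⟨g, hg⟩ := cauchySeq_tendsto_of_complete hcau
  have hgm : MemLp g (ENNReal.ofReal p) μ := Lp.memLp g
  have hgg : hgm.toLp g = g := Lp.toLp_coeFn g hgm
  refine ⟨g, hgm, ?_, ?_⟩
  · set c := μ univ ^ (1 / (1 : ℝ≥0∞).toReal - 1 / (ENNReal.ofReal p).toReal)
    have hc : c ≠ ∞ := by
      refine ENNReal.rpow_ne_top_of_nonneg ?_ (measure_ne_top _ _)
      rw [ENNReal.toReal_ofReal hp0.le, ENNReal.toReal_one, sub_nonneg, div_one]
      exact (div_le_one hp0).2 hp.le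
    have h1 : Filter.Tendsto (fun n => ‖(hf n).toLp (f n) - g‖ * c.toReal) Filter.atTop
        (nhds 0) := by
      simpa using (tendsto_iff_norm_sub_tendsto_zero.1 hg).mul_const c.toReal
    refine squeeze_zero (fun n => integral_nonneg fun x => abs_nonneg _) (fun n => ?_) h1
    have h2 := eLpNorm_le_eLpNorm_mul_rpow_measure_univ hp1 ((hf n).sub hgm).1
    have h3 := ENNReal.toReal_mono (ENNReal.mul_ne_top ((hf n).sub hgm).eLpNorm_ne_top hc) h2
    have h4 := integral_norm_eq_lintegral_enorm ((hf n).sub hgm).1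
    rw [ENNReal.toReal_mul, eLpNorm_one_eq_lintegral_enorm, ← h4,
      ← Lp.norm_toLp _ ((hf n).sub hgm), MemLp.toLp_sub (hf n) hgm, hgg] at h3
    exact h3
  · have h1 := hg.norm.rpow_const (p := p) (Or.inr hp0.le)
    rw [← hgg, norm_toLp_rpow hp0 hgm] at h1
    simpa only [norm_toLp_rpow hp0 (hf _)] using h1

namespace CompactMetricGraph

namespace Sobolev

variable {V E : Type*} [Fintype V] [Fintype E] {G : CompactMetricGraph V E} {p : E → ℝ}

/-! ### Limits of Sobolev functions -/

/-- If the vertex values converge and the derivatives converge in `L¹`, then Sobolev functions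
converge uniformly on every edge, and the limit is a Sobolev function. -/
theorem exists_tendsto (hp : ∀ e, 1 < p e) {u : ℕ → G.Sobolev p} {A : V → ℝ}
    (hA : ∀ w, Filter.Tendsto (fun n => (u n).atVertex w) Filter.atTop (nhds (A w)))
    {g : E → ℝ → ℝ} (hg : ∀ e, MemLp (g e) (ENNReal.ofReal (p e)) (G.edgeMeasure e))
    (hu : ∀ e, Filter.Tendsto (fun n => ∫ x, |(u n).der e x - g e x| ∂(G.edgeMeasure e))
      Filter.atTop (nhds 0)) :
    ∃ w : G.Sobolev p, w.der = g ∧ w.atVertex = A ∧ ∃ η : E → ℕ → ℝ,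
      (∀ e, Filter.Tendsto (η e) Filter.atTop (nhds 0)) ∧
      ∀ e n, ∀ x ∈ Icc 0 (G.length e), |(u n).val e x - w.val e x| ≤ η e n := by
  have hgi : ∀ e, IntegrableOn (g e) (Ioo 0 (G.length e)) := fun e =>
    (hg e).integrable (ENNReal.one_le_ofReal.2 (hp e).le)
  have hbound : ∀ e n, ∀ x ∈ Icc 0 (G.length e),
      |(u n).val e x - (A (G.init e) + ∫ t in (0 : ℝ)..x, g e t)| ≤
        |(u n).atVertex (G.init e) - A (G.init e)|
          + ∫ x, |(u n).der e x - g e x| ∂(G.edgeMeasure e) := by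
    intro e n x hx
    have hdi : IntegrableOn ((u n).der e) (Ioo 0 (G.length e)) := (u n).integrable_der hp e
    have hi : ∀ h : ℝ → ℝ, IntegrableOn h (Ioo 0 (G.length e)) →
        IntervalIntegrable h volume 0 x := fun h hh =>
      (intervalIntegrable_iff_integrableOn_Ioo_of_le hx.1).2
        (hh.mono_set (Ioo_subset_Ioo_right hx.2))
    rw [((u n).isWeakDerivOn e).eq_add_integral (G.length_pos e) ((u n).continuousOn_val e) hdi x hx,
      (u n).val_init, add_sub_add_comm, ← intervalIntegral.integral_sub (hi _ hdi) (hi _ (hgi e))]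
    refine (abs_add_le _ _).trans (add_le_add_right ?_ _)
    rw [intervalIntegral.integral_of_le hx.1, integral_Ioc_eq_integral_Ioo]
    exact abs_integral_le_integral_abs.trans (setIntegral_mono_set (hdi.sub (hgi e)).abs
      (ae_of_all _ fun t => abs_nonneg _) (Ioo_subset_Ioo_right hx.2).eventuallyLE)
  have hη : ∀ e, Filter.Tendsto (fun n => |(u n).atVertex (G.init e) - A (G.init e)|
      + ∫ x, |(u n).der e x - g e x| ∂(G.edgeMeasure e)) Filter.atTop (nhds 0) := by
    intro e
    simpa using ((hA (G.init e)).sub_const (A (G.init e))).abs.add (hu e)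
  have hcont : ∀ e, ContinuousOn (fun x => A (G.init e) + ∫ t in (0 : ℝ)..x, g e t)
      (Icc 0 (G.length e)) := by
    intro e
    have := intervalIntegral.continuousOn_primitive_interval (μ := volume) (f := g e) (a := 0)
      (b := G.length e)
    rw [uIcc_of_le (G.length_pos e).le] at this
    exact continuousOn_const.add (this (by
      rw [integrableOn_Icc_iff_integrableOn_Ioo]; exact hgi e))
  -- The limit is built from its initial values and derivatives; convergence at the terminal
  -- vertices then shows that it is continuous there.
  refine ⟨{ val := fun e x => A (G.init e) + ∫ t in (0 : ℝ)..x, g e t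
            der := g
            atVertex := A
            memLp_val := fun e => ?_
            memLp_der := hg
            isWeakDerivOn := fun e =>
              isWeakDerivOn_const_add_integral (G.length_pos e) (hgi e) _
            continuousOn_val := hcont
            val_init := fun e => by simp
            val_term := fun e => ?_ }, rfl, rfl, _, hη, hbound⟩
  · obtain ⟨C, hC⟩ := isCompact_Icc.exists_bound_of_continuousOn (hcont e)
    exact MemLp.of_bound (G.aestronglyMeasurable_of_continuousOn e (hcont e)) C
      ((G.ae_mem_Icc e).mono fun x hx => hC x hx)
  · refine tendsto_nhds_unique ?_ (hA (G.term e))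
    refine tendsto_iff_norm_sub_tendsto_zero.2
      (squeeze_zero (fun n => norm_nonneg _) (fun n => ?_) (hη e))
    have := hbound e n _ (right_mem_Icc.2 (G.length_pos e).le)
    rwa [(u n).val_term] at this

/-! ### The energy functional -/

/-- The energy whose Euler–Lagrange equation is the weak form of the problem. -/
noncomputable def energy (γ : E → ℝ → ℝ) (f : G.L1) (ω : V → ℝ) (u : G.Sobolev p) : ℝ :=
  ∑ e, ∫ x, primitive (γ e) (u.val e x) ∂(G.edgeMeasure e)
    + ∑ e, (∫ x, |u.der e x| ^ p e ∂(G.edgeMeasure e)) / p e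
    - ∑ e, ∫ x, f e x * u.val e x ∂(G.edgeMeasure e) - ∑ w, ω w * u.atVertex w

/-- The energy is continuous under uniform convergence together with convergence of the integrals
`∫ |u'| ^ p`. -/
theorem tendsto_energy {γ : E → ℝ → ℝ} (hc : ∀ e, Continuous (γ e))
    (f : G.L1) (ω : V → ℝ) {u : ℕ → G.Sobolev p} {w : G.Sobolev p}
    (hA : ∀ v, Filter.Tendsto (fun n => (u n).atVertex v) Filter.atTop (nhds (w.atVertex v)))
    (hder : ∀ e, Filter.Tendsto (fun n => ∫ x, |(u n).der e x| ^ p e ∂(G.edgeMeasure e))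
      Filter.atTop (nhds (∫ x, |w.der e x| ^ p e ∂(G.edgeMeasure e))))
    {η : E → ℕ → ℝ} (hη : ∀ e, Filter.Tendsto (η e) Filter.atTop (nhds 0))
    (hval : ∀ e n, ∀ x ∈ Icc 0 (G.length e), |(u n).val e x - w.val e x| ≤ η e n) :
    Filter.Tendsto (fun n => (u n).energy γ f ω) Filter.atTop (nhds (w.energy γ f ω)) := by
  have hlim : ∀ e, ∀ x ∈ Icc 0 (G.length e),
      Filter.Tendsto (fun n => (u n).val e x) Filter.atTop (nhds (w.val e x)) := fun e x hx =>
    tendsto_iff_norm_sub_tendsto_zero.2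
      (squeeze_zero (fun n => norm_nonneg _) (fun n => hval e n x hx) (hη e))
  have hbdd : ∀ e, ∃ R : ℝ, ∀ n, ∀ x ∈ Icc 0 (G.length e), |(u n).val e x| ≤ R := by
    intro e
    obtain ⟨M, hM⟩ := (hη e).bddAbove_range
    obtain ⟨C, hC⟩ := isCompact_Icc.exists_bound_of_continuousOn (w.continuousOn_val e)
    refine ⟨M + C, fun n x hx => ?_⟩
    have h1 := (hval e n x hx).trans (hM ⟨n, rfl⟩)
    have h2 := hC x hx
    rw [Real.norm_eq_abs] at h2
    have h3 := abs_sub_abs_le_abs_sub ((u n).val e x) (w.val e x)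
    linarith
  refine ((Filter.Tendsto.add (tendsto_finsetSum _ fun e _ => ?_)
    (tendsto_finsetSum _ fun e _ => (hder e).div_const _)).sub
    (tendsto_finsetSum _ fun e _ => ?_)).sub
    (tendsto_finsetSum _ fun v _ => (hA v).const_mul _)
  · obtain ⟨R, hR⟩ := hbdd e
    have hΓ := continuous_primitive (hc e)
    obtain ⟨M, hM⟩ := (isCompact_Icc (a := -R) (b := R)).exists_bound_of_continuousOn
      hΓ.continuousOn
    refine tendsto_integral_of_dominated_convergence (fun _ => M)
      (fun n => G.aestronglyMeasurable_of_continuousOn e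
        (hΓ.comp_continuousOn ((u n).continuousOn_val e))) (integrable_const _)
      (fun n => (G.ae_mem_Icc e).mono fun x hx => hM _ (abs_le.1 (hR n x hx)))
      ((G.ae_mem_Icc e).mono fun x hx => (hΓ.tendsto _).comp (hlim e x hx))
  · obtain ⟨R, hR⟩ := hbdd e
    have hf := L1.integrable_coeFn (f e)
    refine tendsto_integral_of_dominated_convergence (fun x => |f e x| * R)
      (fun n => (G.integrable_mul_of_continuousOn e hf ((u n).continuousOn_val e)).1)
      (hf.abs.mul_const R)
      (fun n => (G.ae_mem_Icc e).mono fun x hx => ?_)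
      ((G.ae_mem_Icc e).mono fun x hx => (hlim e x hx).const_mul _)
    rw [Real.norm_eq_abs, abs_mul]
    exact mul_le_mul_of_nonneg_left (hR n x hx) (abs_nonneg _)

/-- The energy is midpoint convex, with a gain: the convexity defect of the derivative terms. -/
theorem energy_midpoint_add_le (hp : ∀ e, 1 < p e) {γ : E → ℝ → ℝ} (hc : ∀ e, Continuous (γ e))
    (hm : ∀ e, Monotone (γ e)) (f : G.L1) (ω : V → ℝ) (u w : G.Sobolev p) :
    (lin (1 / 2) u (1 / 2) w hp).energy γ f ω
      + ∑ e, (∫ x, ((|u.der e x| ^ p e + |w.der e x| ^ p e) / 2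
          - |(u.der e x + w.der e x) / 2| ^ p e) ∂(G.edgeMeasure e)) / p e
      ≤ (u.energy γ f ω + w.energy γ f ω) / 2 := by
  have h1 : ∀ e, ∫ x, primitive (γ e) ((lin (1 / 2) u (1 / 2) w hp).val e x) ∂(G.edgeMeasure e)
      ≤ (∫ x, primitive (γ e) (u.val e x) ∂(G.edgeMeasure e)
        + ∫ x, primitive (γ e) (w.val e x) ∂(G.edgeMeasure e)) / 2 := by
    intro e
    have hΓ := continuous_primitive (hc e)
    have i : ∀ v : G.Sobolev p,
        Integrable (fun x => primitive (γ e) (v.val e x)) (G.edgeMeasure e) := fun v =>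
      G.integrable_of_continuousOn e (hΓ.comp_continuousOn (v.continuousOn_val e))
    rw [← integral_add (i u) (i w), ← integral_div]
    refine integral_mono (i _) (((i u).add (i w)).div_const 2) fun x => ?_
    have := primitive_midpoint_le (hc e) (hm e) (u.val e x) (w.val e x)
    have h2 : (lin (1 / 2) u (1 / 2) w hp).val e x = (u.val e x + w.val e x) / 2 := by
      simp only [lin]; ring
    simp only [h2]
    exact this
  have h2 : ∀ e, (∫ x, |(lin (1 / 2) u (1 / 2) w hp).der e x| ^ p e ∂(G.edgeMeasure e)) / p e
      + (∫ x, ((|u.der e x| ^ p e + |w.der e x| ^ p e) / 2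
          - |(u.der e x + w.der e x) / 2| ^ p e) ∂(G.edgeMeasure e)) / p e
      = ((∫ x, |u.der e x| ^ p e ∂(G.edgeMeasure e)) / p e
        + (∫ x, |w.der e x| ^ p e ∂(G.edgeMeasure e)) / p e) / 2 := by
    intro e
    have i1 := u.integrable_abs_der_rpow hp e
    have i2 := w.integrable_abs_der_rpow hp e
    have i3 := (lin (1 / 2) u (1 / 2) w hp).integrable_abs_der_rpow hp e
    have hd : ∀ x, (lin (1 / 2) u (1 / 2) w hp).der e x = (u.der e x + w.der e x) / 2 := fun x => by
      simp only [lin]; ring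
    simp only [hd] at i3 ⊢
    have e1 := integral_sub ((i1.add i2).div_const 2) i3
    have e2 := integral_add i1 i2
    simp only [Pi.add_apply, integral_div] at e1 e2
    rw [e1, e2]
    ring
  have h3 : ∀ e, ∫ x, f e x * (lin (1 / 2) u (1 / 2) w hp).val e x ∂(G.edgeMeasure e)
      = (∫ x, f e x * u.val e x ∂(G.edgeMeasure e)
        + ∫ x, f e x * w.val e x ∂(G.edgeMeasure e)) / 2 := by
    intro e
    have hf := L1.integrable_coeFn (f e)
    rw [← integral_add (G.integrable_mul_of_continuousOn e hf (u.continuousOn_val e))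
      (G.integrable_mul_of_continuousOn e hf (w.continuousOn_val e)), ← integral_div]
    congr 1
    ext x
    simp only [lin]
    ring
  have h4 : ∀ v, ω v * (lin (1 / 2) u (1 / 2) w hp).atVertex v
      = (ω v * u.atVertex v + ω v * w.atVertex v) / 2 := fun v => by
    simp only [lin]; ring
  have s1 := Finset.sum_le_sum fun e (_ : e ∈ Finset.univ) => h1 e
  have s2 := Finset.sum_congr rfl fun e (_ : e ∈ Finset.univ) => h2 e
  have s3 := Finset.sum_congr rfl fun e (_ : e ∈ Finset.univ) => h3 e
  have s4 := Finset.sum_congr rfl fun v (_ : v ∈ Finset.univ) => h4 v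
  simp only [← Finset.sum_div, Finset.sum_add_distrib] at s1 s2 s3 s4
  simp only [energy]
  linarith

/-! ### Minimization of the energy -/

/-- Coercivity: a vertex value and the `L^p` norms of the derivatives are bounded in terms of the
energy. The superlinear growth of one primitive on one edge dominates the linear terms up to a
multiple of the variation, which in turn is absorbed by the `p`-th powers of the derivatives. -/
theorem exists_abs_atVertex_add_le_energy [Nonempty E] (hG : G.IsConnected) (hp : ∀ e, 1 < p e)
    {γ : E → ℝ → ℝ} (hc : ∀ e, Continuous (γ e)) (hm : ∀ e, Monotone (γ e))
    (hs : ∀ e, Function.Surjective (γ e)) (h0 : ∀ e, γ e 0 = 0) (f : G.L1) (ω : V → ℝ) (w₀ : V) :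
    ∃ C : ℝ, ∀ u : G.Sobolev p,
      |u.atVertex w₀| + ∑ e, 1 / (2 * p e) * ∫ x, |u.der e x| ^ p e ∂(G.edgeMeasure e)
        ≤ u.energy γ f ω + C := by
  obtain ⟨C₁, hC₁, hosc⟩ := exists_abs_sub_le (p := p) hG hp w₀
  obtain ⟨e₀⟩ := ‹Nonempty E›
  have hl := G.length_pos e₀
  set A₁ := ∑ e, ∫ x, |f e x| ∂(G.edgeMeasure e) with hA₁
  set A₂ := ∑ w, |ω w| with hA₂
  have hA₁0 : 0 ≤ A₁ := Finset.sum_nonneg fun _ _ => integral_nonneg fun _ => abs_nonneg _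
  have hA₂0 : 0 ≤ A₂ := Finset.sum_nonneg fun _ _ => abs_nonneg _
  -- This slope makes the primitive on `e₀` outweigh the linear terms by one unit.
  set K := (A₁ + A₂ + 1) / G.length e₀ with hK
  have hK0 : 0 ≤ K := by positivity
  obtain ⟨CK, hCK⟩ := exists_mul_abs_sub_le_primitive (hc e₀) (hm e₀) (hs e₀) K
  set B := (2 * (A₁ + A₂) + 1) * C₁ with hB
  have hB0 : 0 ≤ B := by positivity
  have hY := fun e => exists_mul_le_rpow_add (hp e) (ε := 1 / (2 * p e))
    (by have := hp e; positivity) hB0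
  choose c hcY using hY
  refine ⟨G.length e₀ * CK + ∑ e, c e * G.length e, fun u => ?_⟩
  obtain ⟨hosc1, hosc2⟩ := hosc u
  set D := u.variation with hD
  set b := |u.atVertex w₀| with hb
  have hΓi : ∀ e, Integrable (fun x => primitive (γ e) (u.val e x)) (G.edgeMeasure e) := fun e =>
    G.integrable_of_continuousOn e
      ((continuous_primitive (hc e)).comp_continuousOn (u.continuousOn_val e))
  have h1 : (A₁ + A₂ + 1) * (b - C₁ * D) - G.length e₀ * CK
      ≤ ∑ e, ∫ x, primitive (γ e) (u.val e x) ∂(G.edgeMeasure e) := by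
    have h2 : ∫ x, primitive (γ e₀) (u.val e₀ x) ∂(G.edgeMeasure e₀)
        ≤ ∑ e, ∫ x, primitive (γ e) (u.val e x) ∂(G.edgeMeasure e) :=
      Finset.single_le_sum (f := fun e => ∫ x, primitive (γ e) (u.val e x) ∂(G.edgeMeasure e))
        (fun e _ => integral_nonneg fun x => primitive_nonneg (hc e) (hm e) (h0 e) _)
        (Finset.mem_univ e₀)
    refine le_trans ?_ h2
    have h3 := integral_mono_ae (integrable_const (K * (b - C₁ * D) - CK)) (hΓi e₀)
      ((G.ae_mem_Icc e₀).mono fun x hx => by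
        have h4 := hosc2 e₀ x hx
        rw [abs_sub_comm] at h4
        have h5 := abs_sub_abs_le_abs_sub (u.atVertex w₀) (u.val e₀ x)
        have h6 : b - C₁ * D ≤ |u.val e₀ x| := by linarith
        have h7 := mul_le_mul_of_nonneg_left h6 hK0
        have h8 := hCK (u.val e₀ x)
        show K * (b - C₁ * D) - CK ≤ primitive (γ e₀) (u.val e₀ x)
        linarith)
    rw [integral_const, G.edgeMeasure_real_univ, smul_eq_mul] at h3
    have h9 : G.length e₀ * K = A₁ + A₂ + 1 := by rw [hK]; field_simp
    calc _ = G.length e₀ * (K * (b - C₁ * D) - CK) := by rw [← h9]; ring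
      _ ≤ _ := h3
  have h2 : ∑ e, ∫ x, f e x * u.val e x ∂(G.edgeMeasure e) ≤ A₁ * (b + C₁ * D) := by
    rw [hA₁, Finset.sum_mul]
    refine Finset.sum_le_sum fun e _ => ?_
    have hf := L1.integrable_coeFn (f e)
    rw [← integral_mul_const]
    refine integral_mono_ae (G.integrable_mul_of_continuousOn e hf (u.continuousOn_val e))
      (hf.abs.mul_const _) ((G.ae_mem_Icc e).mono fun x hx => ?_)
    have h4 := hosc2 e x hx
    have h5 := abs_sub_abs_le_abs_sub (u.val e x) (u.atVertex w₀)
    refine (le_abs_self _).trans ?_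
    rw [abs_mul]
    exact mul_le_mul_of_nonneg_left (by linarith) (abs_nonneg _)
  have h3 : ∑ w, ω w * u.atVertex w ≤ A₂ * (b + C₁ * D) := by
    rw [hA₂, Finset.sum_mul]
    refine Finset.sum_le_sum fun w _ => ?_
    have h4 := hosc1 w
    have h5 := abs_sub_abs_le_abs_sub (u.atVertex w) (u.atVertex w₀)
    refine (le_abs_self _).trans ?_
    rw [abs_mul]
    exact mul_le_mul_of_nonneg_left (by linarith) (abs_nonneg _)
  have h4 : B * D ≤ ∑ e, 1 / (2 * p e) * ∫ x, |u.der e x| ^ p e ∂(G.edgeMeasure e)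
      + ∑ e, c e * G.length e := by
    rw [hD, variation, Finset.mul_sum, ← Finset.sum_add_distrib]
    refine Finset.sum_le_sum fun e _ => ?_
    have i1 := (u.integrable_abs_der_rpow hp e).const_mul (1 / (2 * p e))
    have h5 := integral_mono ((u.integrable_der hp e).abs.const_mul B)
      (i1.add (integrable_const (c e))) fun x => hcY e _ (abs_nonneg (u.der e x))
    have h6 := integral_add i1 (integrable_const (c e))
    simp only [Pi.add_apply] at h5
    rw [h6, integral_const_mul, integral_const_mul, integral_const, G.edgeMeasure_real_univ,
      smul_eq_mul] at h5
    linarith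
  have h5 : ∑ e, (∫ x, |u.der e x| ^ p e ∂(G.edgeMeasure e)) / p e
      = 2 * ∑ e, 1 / (2 * p e) * ∫ x, |u.der e x| ^ p e ∂(G.edgeMeasure e) := by
    rw [Finset.mul_sum]
    refine Finset.sum_congr rfl fun e _ => ?_
    have := hp e
    field_simp
  have h6 : (A₁ + A₂ + 1) * (b - C₁ * D) - A₁ * (b + C₁ * D) - A₂ * (b + C₁ * D) = b - B * D := by
    rw [hB]; ring
  rw [energy, h5]
  linarith

/-- The energy attains its minimum. By the midpoint inequality, the convexity defects along a
minimizing sequence tend to zero, so that the derivatives converge strongly. -/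
theorem exists_energy_le [Nonempty E] (hG : G.IsConnected) (hp : ∀ e, 1 < p e)
    {γ : E → ℝ → ℝ} (hc : ∀ e, Continuous (γ e)) (hm : ∀ e, Monotone (γ e))
    (hs : ∀ e, Function.Surjective (γ e)) (h0 : ∀ e, γ e 0 = 0) (f : G.L1) (ω : V → ℝ) :
    ∃ u : G.Sobolev p, ∀ w : G.Sobolev p, u.energy γ f ω ≤ w.energy γ f ω := by
  have hco := exists_abs_atVertex_add_le_energy (p := p) hG hp hc hm hs h0 f ω
  choose C hC using hco
  have hterm : ∀ (u : G.Sobolev p) e,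
      0 ≤ 1 / (2 * p e) * ∫ x, |u.der e x| ^ p e ∂(G.edgeMeasure e) := fun u e => by
    have := hp e
    have : 0 ≤ ∫ x, |u.der e x| ^ p e ∂(G.edgeMeasure e) := integral_nonneg fun x => by positivity
    positivity
  have hsum := fun u : G.Sobolev p => Finset.sum_nonneg fun e (_ : e ∈ Finset.univ) => hterm u e
  have hbdd : BddBelow (range fun u : G.Sobolev p => u.energy γ f ω) := by
    obtain ⟨e₀⟩ := ‹Nonempty E›
    refine ⟨-C (G.init e₀), ?_⟩
    rintro _ ⟨u, rfl⟩
    have h1 := hC (G.init e₀) u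
    have h2 := abs_nonneg (u.atVertex (G.init e₀))
    have h3 := hsum u
    show _ ≤ u.energy γ f ω
    linarith
  have : Nonempty (G.Sobolev p) := ⟨{
    val := fun _ _ => 0
    der := fun _ _ => 0
    atVertex := fun _ => 0
    memLp_val := fun _ => MemLp.zero
    memLp_der := fun _ => MemLp.zero
    isWeakDerivOn := fun _ φ _ _ _ => by simp
    continuousOn_val := fun _ => continuousOn_const
    val_init := fun _ => rfl
    val_term := fun _ => rfl }⟩
  set m := ⨅ u : G.Sobolev p, u.energy γ f ω with hmdef
  have hmle : ∀ u : G.Sobolev p, m ≤ u.energy γ f ω := fun u => ciInf_le hbdd u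
  have hseq : ∀ n : ℕ, ∃ u : G.Sobolev p, u.energy γ f ω < m + 1 / ((n : ℝ) + 1) := fun n =>
    exists_lt_of_ciInf_lt (lt_add_of_pos_right _ Nat.one_div_pos_of_nat)
  choose u hu using hseq
  have hu1 : ∀ n, (u n).energy γ f ω ≤ m + 1 := fun n =>
    (hu n).le.trans (by
      gcongr
      rw [div_le_one (by positivity)]
      linarith [Nat.cast_nonneg (α := ℝ) n])
  have hδ : Filter.Tendsto (fun n : ℕ => 1 / ((n : ℝ) + 1)) Filter.atTop (nhds 0) :=
    tendsto_one_div_add_atTop_nhds_zero_nat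
  have hlim : ∀ e, ∃ g : ℝ → ℝ, MemLp g (ENNReal.ofReal (p e)) (G.edgeMeasure e) ∧
      Filter.Tendsto (fun n => ∫ x, |(u n).der e x - g x| ∂(G.edgeMeasure e)) Filter.atTop
        (nhds 0) ∧
      Filter.Tendsto (fun n => ∫ x, |(u n).der e x| ^ p e ∂(G.edgeMeasure e)) Filter.atTop
        (nhds (∫ x, |g x| ^ p e ∂(G.edgeMeasure e))) := by
    intro e
    have hpe : 0 < p e := by linarith [hp e]
    refine exists_tendsto_of_midpoint_defect (hp e) (fun n => (u n).memLp_der e)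
      (R := 2 * p e * (m + 1 + C (G.init e))) (fun n => ?_)
      (δ := fun n => p e * (1 / ((n : ℝ) + 1))) (by simpa using hδ.const_mul (p e))
      (fun n k => ?_)
    · have h1 := hC (G.init e) (u n)
      have h2 := abs_nonneg ((u n).atVertex (G.init e))
      have h3 := Finset.single_le_sum (fun e _ => hterm (u n) e) (Finset.mem_univ e)
      have h4 : 1 / (2 * p e) * ∫ x, |(u n).der e x| ^ p e ∂(G.edgeMeasure e)
          ≤ m + 1 + C (G.init e) := by linarith [hu1 n]
      rw [one_div, inv_mul_le_iff₀ (by positivity)] at h4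
      exact h4
    · have h1 := energy_midpoint_add_le hp hc hm f ω (u n) (u k)
      have hd : ∀ e, 0 ≤ (∫ x, ((|(u n).der e x| ^ p e + |(u k).der e x| ^ p e) / 2
          - |((u n).der e x + (u k).der e x) / 2| ^ p e) ∂(G.edgeMeasure e)) / p e := fun e =>
        div_nonneg (integral_nonneg fun x => sub_nonneg.2 (abs_midpoint_rpow_le (hp e) _ _))
          (by linarith [hp e])
      have h2 := Finset.single_le_sum (fun e _ => hd e) (Finset.mem_univ e)
      have h3 := hmle (lin (1 / 2) (u n) (1 / 2) (u k) hp)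
      have h4 : (∫ x, ((|(u n).der e x| ^ p e + |(u k).der e x| ^ p e) / 2
          - |((u n).der e x + (u k).der e x) / 2| ^ p e) ∂(G.edgeMeasure e)) / p e
          ≤ 1 / ((n : ℝ) + 1) + 1 / ((k : ℝ) + 1) := by
        have h5 : 0 < 1 / ((n : ℝ) + 1) := by positivity
        have h6 : 0 < 1 / ((k : ℝ) + 1) := by positivity
        linarith [hu n, hu k]
      rw [div_le_iff₀ hpe] at h4
      linarith
  choose g hg hg1 hg2 using hlim
  -- Coercivity with each vertex as base point bounds all vertex values.
  have hvb : ∃ R : ℝ, ∀ n, (u n).atVertex ∈ Metric.closedBall (0 : V → ℝ) R := by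
    refine ⟨∑ w, |m + 1 + C w|, fun n => ?_⟩
    rw [mem_closedBall_zero_iff, pi_norm_le_iff_of_nonneg (by positivity)]
    intro w
    have h1 := hC w (u n)
    have h2 := hsum (u n)
    have h3 := Finset.single_le_sum (f := fun w => |m + 1 + C w|) (fun _ _ => abs_nonneg _)
      (Finset.mem_univ w)
    have h4 := le_abs_self (m + 1 + C w)
    rw [Real.norm_eq_abs]
    linarith [hu1 n]
  obtain ⟨R, hR⟩ := hvb
  obtain ⟨A, -, s, hsm, hA⟩ := (isCompact_closedBall (0 : V → ℝ) R).tendsto_subseq hR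
  have hst := hsm.tendsto_atTop
  obtain ⟨w, hw1, hw2, η, hη, hval⟩ := exists_tendsto hp (u := fun n => u (s n))
    (fun v => (tendsto_pi_nhds.1 hA) v) hg (fun e => (hg1 e).comp hst)
  have hE := tendsto_energy (w := w) hc f ω
    (fun v => by rw [hw2]; exact (tendsto_pi_nhds.1 hA) v)
    (fun e => by rw [hw1]; exact (hg2 e).comp hst) hη hval
  refine ⟨w, fun w' => le_trans ?_ (hmle w')⟩
  have hE2 : Filter.Tendsto (fun n => m + 1 / ((s n : ℝ) + 1)) Filter.atTop (nhds m) := by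
    simpa using (hδ.comp hst).const_add m
  exact le_of_tendsto_of_tendsto' hE hE2 fun n => (hu (s n)).le

/-! ### The Euler–Lagrange equation -/

/-- The derivative of the energy at `u` in the direction `φ`. -/
theorem hasDerivAt_energy (hp : ∀ e, 1 < p e) {γ : E → ℝ → ℝ} (hc : ∀ e, Continuous (γ e))
    (f : G.L1) (ω : V → ℝ) (u φ : G.Sobolev p) :
    HasDerivAt (fun t => (lin 1 u t φ hp).energy γ f ω)
      (∑ e, ∫ x, γ e (u.val e x) * φ.val e x ∂(G.edgeMeasure e)
        + ∑ e, ∫ x, |u.der e x| ^ (p e - 2) * u.der e x * φ.der e x ∂(G.edgeMeasure e)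
        - ∑ e, ∫ x, f e x * φ.val e x ∂(G.edgeMeasure e) - ∑ w, ω w * φ.atVertex w) 0 := by
  refine ((HasDerivAt.add (HasDerivAt.fun_sum fun e _ => ?_)
    (HasDerivAt.fun_sum fun e _ => ?_)).sub (HasDerivAt.fun_sum fun e _ => ?_)).sub
    (HasDerivAt.fun_sum fun v _ => ?_)
  · obtain ⟨R, hR⟩ := isCompact_Icc.exists_bound_of_continuousOn (u.continuousOn_val e)
    obtain ⟨S, hS⟩ := isCompact_Icc.exists_bound_of_continuousOn (φ.continuousOn_val e)
    obtain ⟨M, hM⟩ := (isCompact_Icc (a := -(R + S)) (b := R + S)).exists_bound_of_continuousOn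
      (hc e).continuousOn
    have hΓ := continuous_primitive (hc e)
    have h := (hasDerivAt_integral_of_dominated_loc_of_deriv_le (μ := G.edgeMeasure e)
      (F := fun t x => primitive (γ e) ((lin 1 u t φ hp).val e x))
      (F' := fun t x => γ e ((lin 1 u t φ hp).val e x) * φ.val e x) (x₀ := (0 : ℝ))
      (bound := fun _ => M * S)
      (Metric.ball_mem_nhds 0 one_pos)
      (Filter.Eventually.of_forall fun t => G.aestronglyMeasurable_of_continuousOn e
        (hΓ.comp_continuousOn ((lin 1 u t φ hp).continuousOn_val e)))
      (G.integrable_of_continuousOn e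
        (hΓ.comp_continuousOn ((lin 1 u 0 φ hp).continuousOn_val e)))
      (G.aestronglyMeasurable_of_continuousOn e
        (((hc e).comp_continuousOn ((lin 1 u 0 φ hp).continuousOn_val e)).mul
          (φ.continuousOn_val e)))
      ((G.ae_mem_Icc e).mono fun x hx t ht => ?_) (integrable_const _)
      (Filter.Eventually.of_forall fun x t _ => ?_)).2
    · simpa [lin] using h
    · have ht1 : |t| ≤ 1 := by simpa using (Metric.mem_ball.1 ht).le
      have h1 : |(lin 1 u t φ hp).val e x| ≤ R + S := by
        simp only [lin, one_mul]
        refine (abs_add_le _ _).trans (add_le_add (hR x hx) ?_)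
        rw [abs_mul]
        exact (mul_le_of_le_one_left (abs_nonneg _) ht1).trans (hS x hx)
      have h2 := hM _ (abs_le.1 h1)
      rw [norm_mul]
      exact mul_le_mul h2 (hS x hx) (norm_nonneg _) ((norm_nonneg _).trans h2)
    · have h1 : HasDerivAt (fun t => (lin 1 u t φ hp).val e x) (φ.val e x) t := by
        simpa [lin] using ((hasDerivAt_id t).mul_const (φ.val e x)).const_add (u.val e x)
      exact (hasDerivAt_primitive (hc e) _).comp t h1
  · have hpe : 0 < p e := by linarith [hp e]
    have hsum : MemLp (fun x => |u.der e x| + |φ.der e x|) (ENNReal.ofReal (p e))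
        (G.edgeMeasure e) := (u.memLp_der e).norm.add (φ.memLp_der e).norm
    have hsumi := hsum.integrable_norm_rpow'
    rw [ENNReal.toReal_ofReal hpe.le] at hsumi
    have h := (hasDerivAt_integral_of_dominated_loc_of_deriv_le (μ := G.edgeMeasure e)
      (F := fun t x => |(lin 1 u t φ hp).der e x| ^ p e)
      (F' := fun t x => p e * (|(lin 1 u t φ hp).der e x| ^ (p e - 2) * (lin 1 u t φ hp).der e x
        * φ.der e x)) (x₀ := (0 : ℝ))
      (bound := fun x => p e * |(|u.der e x| + |φ.der e x|)| ^ p e)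
      (Metric.ball_mem_nhds 0 one_pos)
      (Filter.Eventually.of_forall fun t => ((lin 1 u t φ hp).integrable_abs_der_rpow hp e).1)
      ((lin 1 u 0 φ hp).integrable_abs_der_rpow hp e)
      (((lin 1 u 0 φ hp).integrable_flux_mul φ hp e).const_mul (p e)).1
      (Filter.Eventually.of_forall fun x t ht => ?_) (hsumi.const_mul (p e))
      (Filter.Eventually.of_forall fun x t _ => ?_)).2
    · have h2 := h.div_const (p e)
      rw [integral_const_mul, mul_div_cancel_left₀ _ hpe.ne'] at h2
      simpa [lin] using h2
    · have ht1 : |t| ≤ 1 := by simpa using (Metric.mem_ball.1 ht).le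
      rw [norm_mul, Real.norm_of_nonneg hpe.le]
      refine mul_le_mul_of_nonneg_left (abs_rpow_sub_two_mul_mul_abs_le (hp e) ?_
        (le_add_of_nonneg_left (abs_nonneg _))) hpe.le
      simp only [lin, one_mul]
      refine (abs_add_le _ _).trans (add_le_add le_rfl ?_)
      rw [abs_mul]
      exact mul_le_of_le_one_left (abs_nonneg _) ht1
    · have h1 : HasDerivAt (fun t => (lin 1 u t φ hp).der e x) (φ.der e x) t := by
        simpa [lin] using ((hasDerivAt_id t).mul_const (φ.der e x)).const_add (u.der e x)
      have h2 := (hasDerivAt_abs_rpow ((lin 1 u t φ hp).der e x) (hp e)).comp t h1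
      rw [mul_assoc (p e), mul_assoc (p e)] at h2
      exact h2
  · have hf := L1.integrable_coeFn (f e)
    have i1 := G.integrable_mul_of_continuousOn e hf (u.continuousOn_val e)
    have i2 := G.integrable_mul_of_continuousOn e hf (φ.continuousOn_val e)
    have h1 : (fun t => ∫ x, f e x * (lin 1 u t φ hp).val e x ∂(G.edgeMeasure e))
        = fun t => ∫ x, f e x * u.val e x ∂(G.edgeMeasure e)
          + t * ∫ x, f e x * φ.val e x ∂(G.edgeMeasure e) := by
      ext t
      rw [← integral_const_mul, ← integral_add i1 (i2.const_mul t)]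
      congr 1
      ext x
      simp only [lin]
      ring
    rw [h1]
    simpa using ((hasDerivAt_id (0 : ℝ)).mul_const
      (∫ x, f e x * φ.val e x ∂(G.edgeMeasure e))).const_add
      (∫ x, f e x * u.val e x ∂(G.edgeMeasure e))
  · have h1 : HasDerivAt (fun t => (lin 1 u t φ hp).atVertex v) (φ.atVertex v) 0 := by
      simpa [lin] using
        ((hasDerivAt_id (0 : ℝ)).mul_const (φ.atVertex v)).const_add (u.atVertex v)
    exact h1.const_mul (ω v)

end Sobolev

section

variable {V E : Type*} [Fintype V] [Fintype E] {G : CompactMetricGraph V E} {p : E → ℝ}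
  {γ : E → ℝ → ℝ} {f : G.L1} {ω : V → ℝ}

/-! ### Existence and uniqueness -/

/-- A minimizer of the energy satisfies the Euler–Lagrange equation, which is the weak form. -/
theorem exists_isWeakSolution [Nonempty E] (hG : G.IsConnected) (hp : ∀ e, 1 < p e)
    (hc : ∀ e, Continuous (γ e)) (hm : ∀ e, Monotone (γ e))
    (hs : ∀ e, Function.Surjective (γ e)) (h0 : ∀ e, γ e 0 = 0) :
    ∃ v : G.L1, G.IsWeakSolution p γ f ω v := by
  obtain ⟨u, hu⟩ := Sobolev.exists_energy_le (p := p) hG hp hc hm hs h0 f ω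
  have hi : ∀ e, Integrable (fun x => γ e (u.val e x)) (G.edgeMeasure e) := fun e =>
    G.integrable_of_continuousOn e ((hc e).comp_continuousOn (u.continuousOn_val e))
  refine ⟨fun e => (hi e).toL1 _, u, fun e => (hi e).coeFn_toL1, fun φ => ?_⟩
  have hmin : IsLocalMin (fun t => (Sobolev.lin 1 u t φ hp).energy γ f ω) 0 := by
    refine Filter.Eventually.of_forall fun t => ?_
    have h1 : Sobolev.lin 1 u 0 φ hp = u := by
      cases u
      simp [Sobolev.lin]
    simp only [h1]
    exact hu _
  have h1 := hmin.hasDerivAt_eq_zero (Sobolev.hasDerivAt_energy hp hc f ω u φ)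
  have h2 : ∀ e, ∫ x, (hi e).toL1 _ x * φ.val e x ∂(G.edgeMeasure e)
      = ∫ x, γ e (u.val e x) * φ.val e x ∂(G.edgeMeasure e) := fun e =>
    integral_congr_ae ((hi e).coeFn_toL1.mono fun x hx => by simp only [hx])
  simp only [h2]
  linarith

/-- Only `v = γ(u)` is unique, not `u`: the monotone terms of the tested difference vanish, so that
`(γ(u₁) - γ(u₂)) (u₁ - u₂) = 0` almost everywhere, and either factor being zero gives
`γ(u₁) = γ(u₂)`. -/
theorem IsWeakSolution.unique (hp : ∀ e, 1 < p e) (hm : ∀ e, Monotone (γ e)) {v w : G.L1}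
    (hv : G.IsWeakSolution p γ f ω v) (hw : G.IsWeakSolution p γ f ω w) : v = w := by
  obtain ⟨u₁, hγ₁, h₁⟩ := hv
  obtain ⟨u₂, hγ₂, h₂⟩ := hw
  -- Test both equations with the difference of the two functions.
  set φ := Sobolev.lin 1 u₁ (-1) u₂ hp with hφ
  have hval : ∀ e x, φ.val e x = u₁.val e x - u₂.val e x := fun e x => by
    simp only [hφ, Sobolev.lin]; ring
  have hder : ∀ e x, φ.der e x = u₁.der e x - u₂.der e x := fun e x => by
    simp only [hφ, Sobolev.lin]; ring
  have iv : ∀ (z : G.L1) e, Integrable (fun x => z e x * φ.val e x) (G.edgeMeasure e) :=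
    fun z e => G.integrable_mul_of_continuousOn e (L1.integrable_coeFn (z e)) (φ.continuousOn_val e)
  have hA : ∀ e, ∫ x, (v e x - w e x) * φ.val e x ∂(G.edgeMeasure e)
      = ∫ x, v e x * φ.val e x ∂(G.edgeMeasure e)
        - ∫ x, w e x * φ.val e x ∂(G.edgeMeasure e) := fun e => by
    rw [← integral_sub (iv v e) (iv w e)]
    simp only [sub_mul]
  have hB : ∀ e, ∫ x, (|u₁.der e x| ^ (p e - 2) * u₁.der e x
        - |u₂.der e x| ^ (p e - 2) * u₂.der e x) * φ.der e x ∂(G.edgeMeasure e)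
      = ∫ x, |u₁.der e x| ^ (p e - 2) * u₁.der e x * φ.der e x ∂(G.edgeMeasure e)
        - ∫ x, |u₂.der e x| ^ (p e - 2) * u₂.der e x * φ.der e x ∂(G.edgeMeasure e) := fun e => by
    rw [← integral_sub (u₁.integrable_flux_mul φ hp e) (u₂.integrable_flux_mul φ hp e)]
    simp only [sub_mul]
  have pA : ∀ e, 0 ≤ᵐ[G.edgeMeasure e] fun x => (v e x - w e x) * φ.val e x := fun e => by
    filter_upwards [hγ₁ e, hγ₂ e] with x hx₁ hx₂
    rw [hx₁, hx₂, hval]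
    rcases le_total (u₁.val e x) (u₂.val e x) with h | h
    · exact mul_nonneg_of_nonpos_of_nonpos (sub_nonpos.2 (hm e h)) (sub_nonpos.2 h)
    · exact mul_nonneg (sub_nonneg.2 (hm e h)) (sub_nonneg.2 h)
  have pA' := fun e => integral_nonneg_of_ae (pA e)
  have pB : ∀ e, 0 ≤ ∫ x, (|u₁.der e x| ^ (p e - 2) * u₁.der e x
        - |u₂.der e x| ^ (p e - 2) * u₂.der e x) * φ.der e x ∂(G.edgeMeasure e) := fun e =>
    integral_nonneg fun x => by
      simp only [hder]
      exact abs_rpow_sub_two_mul_sub_mul_nonneg (hp e) _ _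
  have hsum : ∑ e, ∫ x, (v e x - w e x) * φ.val e x ∂(G.edgeMeasure e) ≤ 0 := by
    have h3 := Finset.sum_nonneg fun e (_ : e ∈ Finset.univ) => pB e
    simp only [hA, hB, Finset.sum_sub_distrib] at h3 ⊢
    linarith [h₁ φ, h₂ φ]
  have hzero : ∀ e, ∫ x, (v e x - w e x) * φ.val e x ∂(G.edgeMeasure e) = 0 := fun e =>
    (Finset.sum_eq_zero_iff_of_nonneg fun e _ => pA' e).1
      (le_antisymm hsum (Finset.sum_nonneg fun e _ => pA' e)) e (Finset.mem_univ e)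
  funext e
  have hint : Integrable (fun x => (v e x - w e x) * φ.val e x) (G.edgeMeasure e) := by
    simp only [sub_mul]
    exact (iv v e).sub (iv w e)
  have hae := (integral_eq_zero_iff_of_nonneg_ae (pA e) hint).1 (hzero e)
  refine Lp.ext ?_
  filter_upwards [hae, hγ₁ e, hγ₂ e] with x hx hx₁ hx₂
  simp only [Pi.zero_apply, mul_eq_zero, hval] at hx
  rcases hx with hx | hx
  · exact sub_eq_zero.1 hx
  · rw [hx₁, hx₂, sub_eq_zero.1 hx]

end

end CompactMetricGraph

theorem mainTheorem2 {V E : Type*} [Fintype V] [Fintype E] [Nonempty E]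
    (G : CompactMetricGraph V E) (hG : G.IsConnected)
    (p : E → ℝ) (hp : ∀ e, 1 < p e)
    (γ : E → ℝ → ℝ) (hγ_cont : ∀ e, Continuous (γ e)) (hγ_mono : ∀ e, Monotone (γ e))
    (hγ_surj : ∀ e, Function.Surjective (γ e)) (hγ_zero : ∀ e, γ e 0 = 0)
    (f : G.L1) (ω : V → ℝ) :
    ∃! v : G.L1, G.IsWeakSolution p γ f ω v := by
  obtain ⟨v, hv⟩ := CompactMetricGraph.exists_isWeakSolution (f := f) (ω := ω) hG hp hγ_cont
    hγ_mono hγ_surj hγ_zero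
  exact ⟨v, hv, fun w hw => hw.unique hp hγ_mono hv⟩
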